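/- Let $h$ and $k$ be coprime integers with $k \geq 1$. Let $\tau(n)$ be the number of positive divisors of $n$, and for coprime integers $p,q$ with $q \geq 1$ let $$V(p,q) = \sum_{j=1}^{q-1} \left\{ \frac{jp}{q} \right\} \cot \frac{j\pi}{q}$$ be the Vasyunin sum, where $\{x\}$ denotes the fractional part of $x$ (so $V(p,1)=0$). The Dirichlet series $$\mathrm{Esin}(s;h/k) = \sum_{n=1}^{\infty} \frac{\tau(n)}{n^{s}} \sin\left(2\pi n \frac{h}{k}\right),$$ absolutely convergent for $\operatorname{Re} s > 1$, extends to an entire function of $s$, again denoted by $\mathrm{Esin}(s;h/k)$. One has $$\mathrm{Esin}(0;h/k) = -\frac{1}{2} V(\overline{h},k)$$ for every integer $\overline{h}$ with $h\overline{h} \equiv 1 \pmod k$. Moreover the series $\sum_{n\ge 1} \frac{\tau(n)}{n}\sin(2\pi n h/k)$ (summed in increasing order of $n$) converges, and $$\mathrm{Esin}(1;h/k) = \sum_{n=1}^{\infty} \frac{\tau(n)}{n} \sin\left(2\pi n \frac{h}{k}\right) = -\frac{\pi^2}{2k} V(h,k).$$ -/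

import Mathlib

open Filter Topology

/-- The coefficients `τ(n) sin (2 π n h / k)`, where `τ(n)` is the number of positive divisors
of `n`. -/
noncomputable def esinCoeff (h : ℤ) (k n : ℕ) : ℝ :=
  (n.divisors.card : ℝ) * Real.sin (2 * Real.pi * n * ((h : ℝ) / k))

/-- `F` is an entire function which, in the half-plane `Re s > 1`, is the sum of the
(absolutely convergent) Dirichlet series `∑_{n ≥ 1} a n / n ^ s`. -/
def IsEntireContinuation (a : ℕ → ℂ) (F : ℂ → ℂ) : Prop :=
  Differentiable ℂ F ∧ ∀ s : ℂ, 1 < s.re → LSeriesHasSum a s (F s)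

/-- An entire continuation is unique, so the choice made in `Esin` below is immaterial. -/
theorem IsEntireContinuation.unique {a : ℕ → ℂ} {F G : ℂ → ℂ}
    (hF : IsEntireContinuation a F) (hG : IsEntireContinuation a G) : F = G := by
  have hFa : AnalyticOnNhd ℂ F Set.univ := hF.1.differentiableOn.analyticOnNhd isOpen_univ
  have hGa : AnalyticOnNhd ℂ G Set.univ := hG.1.differentiableOn.analyticOnNhd isOpen_univ
  refine hFa.eq_of_eventuallyEq (z₀ := 2) hGa ?_
  have hopen : IsOpen {s : ℂ | 1 < s.re} := isOpen_lt continuous_const Complex.continuous_re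
  filter_upwards [hopen.mem_nhds (show (2 : ℂ) ∈ {s : ℂ | 1 < s.re} by simp)] with s hs
  exact (hF.2 s hs).unique (hG.2 s hs)

open Classical in
/-- The sine-Estermann function `Esin(s; h/k)`: the entire function that continues
`∑_{n ≥ 1} τ(n) sin (2 π n h / k) / n ^ s`, `Re s > 1` (and `0` should there be none). -/
noncomputable def Esin (h : ℤ) (k : ℕ) : ℂ → ℂ :=
  if H : ∃ F : ℂ → ℂ, IsEntireContinuation (fun n => (esinCoeff h k n : ℂ)) F
  then H.choose else 0

/-- The Vasyunin sum `V(p,q) = ∑_{j=1}^{q-1} {j p / q} cot (j π / q)`, with `{x}` the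
fractional part of `x`; it is `0` for `q = 1`. -/
noncomputable def vasyuninSum (p : ℤ) (q : ℕ) : ℝ :=
  ∑ j ∈ Finset.Ico 1 q,
    Int.fract ((j : ℝ) * (p : ℝ) / (q : ℝ)) * Real.cot ((j : ℝ) * Real.pi / (q : ℝ))

/-!
The coefficient `τ(n) sin (2 π n h / k)` is the sum of `sin (2 π a b h / k)` over the factorizations
`n = a b`. Sorting these by the residue class `r` of `a` modulo `k`, and using that the sine is odd,
gives for `Re s > 1`
`Esin(s; h/k) = k ^ (-s) ∑_{r mod k} ζ_odd(s, r/k) S(s, h r/k)`,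
where `ζ_odd` is the odd part of the Hurwitz zeta function and `S(s, x) = ∑ sin (2 π n x) / n ^ s`.
Both are entire, hence so is the right-hand side (`isEntireContinuation_esinEntire`).

The special values reduce to `ζ_odd(1, x) = (π / 2) cot (π x)`, which is the Mittag-Leffler expansion
of the cotangent (`hurwitzZetaOdd_one`). As `S(s, a/k)` is a finite sine transform of `ζ_odd(s, r/k)`
and the finite sine transform of the cotangent is a sawtooth (`sum_zmodSin_mul_zmodCot`),
`S(1, a/k)` is a sawtooth in `a`. The functional equation at `s = 1` exchanges these values with
those at `0`. At `s = 0` and at `s = 1` the bilinear expression is thus a sum of products of a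
sawtooth and a cotangent, that is, a Vasyunin sum (`sum_zmodSaw_mul_zmodCot`). At `s = 0` the
cotangent carries the factor `h`, and moving it to the sawtooth turns it into the inverse of `h`.

The series at `s = 1` is treated by the hyperbola method. Partial summation shows that
`∑_{b ≤ y} g(b) / b` is a finite cotangent sum up to `O(1 / y)` for `g` odd and periodic
(`abs_sum_range_odd_div_sub_le`). Applied to `b ↦ sin (2 π a b h / k)`, it replaces the inner sums by
sawtooth values, with an error that tends to zero (`abs_sum_esinCoeff_div_sub_le`); applied to
the sawtooth, it evaluates the outer sum, and the limit is the same Vasyunin sum.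
-/

/-! ### The Mittag-Leffler expansion of the cotangent and the odd Hurwitz zeta function at `1` -/

theorem tendsto_sum_range_cot {x : ℝ} (hx0 : 0 < x) (hx1 : x < 1) :
    Tendsto (fun M : ℕ => ∑ m ∈ Finset.range M, (1 / (m + x) - 1 / (m + 1 - x))) atTop
      (𝓝 (Real.pi * Real.cot (Real.pi * x))) := by
  have hxi : (x : ℂ) ∈ Complex.integerComplement := by
    rintro ⟨n, hn⟩
    have hn' : (n : ℝ) = x := by exact_mod_cast hn
    have h0 : (0 : ℤ) < n := by exact_mod_cast hn' ▸ hx0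
    have h1 : n < (1 : ℤ) := by exact_mod_cast hn' ▸ hx1
    omega
  have h1 : Tendsto (fun M : ℕ => ∑ j ∈ Finset.range M, (1 / (x - (j + 1)) + 1 / (x + (j + 1))))
      atTop (𝓝 (Real.pi * Real.cot (Real.pi * x) - 1 / x)) := by
    have h := (Complex.continuous_re.tendsto _).comp (tendsto_logDeriv_euler_cot_sub hxi)
    have e : ((Real.pi : ℂ) * Complex.cot (Real.pi * x) - 1 / x).re
        = Real.pi * Real.cot (Real.pi * x) - 1 / x := by
      rw [← Complex.ofReal_re (Real.pi * Real.cot (Real.pi * x) - 1 / x)]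
      push_cast
      rfl
    rw [e] at h
    refine h.congr fun M => ?_
    simp only [Function.comp_apply, cotTerm]
    rw [← Complex.ofReal_re (∑ j ∈ Finset.range M, (1 / (x - (j + 1)) + 1 / (x + (j + 1))))]
    push_cast
    rfl
  have h2 : Tendsto (fun M : ℕ => 1 / ((M : ℝ) + x)) atTop (𝓝 0) :=
    (tendsto_const_nhds.div_atTop (tendsto_natCast_atTop_atTop.atTop_add tendsto_const_nhds))
  have h3 := (h1.const_add (1 / x)).sub h2
  rw [add_sub_cancel, sub_zero] at h3
  refine h3.congr fun M => ?_
  induction M with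
  | zero => simp
  | succ M ih =>
    rw [Finset.sum_range_succ, Finset.sum_range_succ, ← ih]
    have e : (x - (M + 1) : ℝ) = -(M + 1 - x) := by ring
    rw [e, div_neg]
    push_cast
    rw [add_comm x ((M : ℝ) + 1)]
    ring

/-- A mean value bound for the paired terms of the series of `hurwitzZetaOdd`, uniform for `s`
near `1`. -/
theorem abs_rpow_sub_rpow_le {x s : ℝ} (hx0 : 0 < x) (hx1 : x < 1) (hs1 : 1 < s) (hs2 : s < 2)
    (n : ℕ) : |(n + x) ^ (-s) - (n + 1 - x) ^ (-s)| ≤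
      2 * (min x (1 - x)) ^ (-3 : ℝ) * (1 / ((n : ℝ) + 1) ^ 2) := by
  set m := min x (1 - x) with hm
  have hm0 : 0 < m := lt_min hx0 (by linarith)
  have hm1 : m ≤ 1 := (min_le_left _ _).trans hx1.le
  have hn : (0 : ℝ) ≤ n := n.cast_nonneg
  have hml : m ≤ x := min_le_left _ _
  have hmr : m ≤ 1 - x := min_le_right _ _
  have hlow : m * (n + 1) ≤ n + m := by nlinarith
  have hbd : ∀ t ∈ Set.Ici ((n : ℝ) + m), ‖-s * t ^ (-s - 1)‖ ≤
      2 * (m ^ (-3 : ℝ) * (1 / ((n : ℝ) + 1) ^ 2)) := by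
    intro t ht
    have ht' : (n : ℝ) + m ≤ t := ht
    have ht0 : 0 < t := by linarith
    rw [norm_mul, norm_neg, Real.norm_of_nonneg (by linarith : (0 : ℝ) ≤ s),
      Real.norm_of_nonneg (Real.rpow_nonneg ht0.le _)]
    refine mul_le_mul hs2.le ?_ (Real.rpow_nonneg ht0.le _) (by norm_num)
    calc t ^ (-s - 1) ≤ (m * (n + 1)) ^ (-s - 1) :=
          Real.rpow_le_rpow_of_nonpos (by positivity) (hlow.trans ht') (by linarith)
      _ = m ^ (-s - 1) * ((n : ℝ) + 1) ^ (-s - 1) := Real.mul_rpow hm0.le (by linarith)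
      _ ≤ m ^ (-3 : ℝ) * ((n : ℝ) + 1) ^ (-2 : ℝ) := by
          refine mul_le_mul (Real.rpow_le_rpow_of_exponent_ge hm0 hm1 (by linarith))
            (Real.rpow_le_rpow_of_exponent_le (by linarith) (by linarith)) (by positivity)
            (by positivity)
      _ = _ := by
          rw [Real.rpow_neg (by positivity : (0 : ℝ) ≤ (n : ℝ) + 1), one_div]
          norm_num
  have h := (convex_Ici ((n : ℝ) + m)).norm_image_sub_le_of_norm_hasDerivWithin_le
    (f := fun t : ℝ => t ^ (-s)) (f' := fun t => -s * t ^ (-s - 1))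
    (C := 2 * (m ^ (-3 : ℝ) * (1 / ((n : ℝ) + 1) ^ 2)))
    (x := (n : ℝ) + 1 - x) (y := n + x)
    (fun t ht => (Real.hasDerivAt_rpow_const
      (Or.inl (by have : (n : ℝ) + m ≤ t := ht; linarith))).hasDerivWithinAt)
    hbd (by simp only [Set.mem_Ici]; linarith) (by simp only [Set.mem_Ici]; linarith)
  rw [Real.norm_eq_abs, Real.norm_eq_abs] at h
  refine h.trans ?_
  have h1 : |(n : ℝ) + x - (n + 1 - x)| ≤ 1 := by rw [abs_le]; constructor <;> linarith
  have h0 : 0 ≤ 2 * (m ^ (-3 : ℝ) * (1 / ((n : ℝ) + 1) ^ 2)) := by positivity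
  calc _ ≤ _ * 1 := mul_le_mul_of_nonneg_left h1 h0
    _ = _ := by ring

/-- The Dirichlet series of the odd Hurwitz zeta function converges only for `Re s > 1`; its
terms, paired as in `tendsto_sum_range_cot`, allow the limit `s → 1` under the sum. -/
theorem hurwitzZetaOdd_one {x : ℝ} (hx0 : 0 < x) (hx1 : x < 1) :
    HurwitzZeta.hurwitzZetaOdd (x : UnitAddCircle) 1 =
      ((Real.pi / 2 * Real.cot (Real.pi * x) : ℝ) : ℂ) := by
  have hq : ∀ n : ℕ, (0 : ℝ) < n + x := fun n => by positivity
  have hr : ∀ n : ℕ, (0 : ℝ) < n + 1 - x := fun n => by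
    have : (0 : ℝ) ≤ n := n.cast_nonneg
    linarith
  have hsumm : Summable (fun n : ℕ =>
      2 * (min x (1 - x)) ^ (-3 : ℝ) * (1 / ((n : ℝ) + 1) ^ 2)) := by
    refine Summable.mul_left _ ?_
    exact_mod_cast (summable_nat_add_iff 1).2 (Real.summable_one_div_nat_pow.2 one_lt_two)
  have hev : ∀ᶠ s : ℝ in 𝓝[>] 1, 1 < s ∧ s < 2 :=
    Ioo_mem_nhdsGT (by norm_num : (1 : ℝ) < 2)
  have hterm : ∀ n : ℕ, Tendsto (fun s : ℝ => ((n + x) ^ (-s) - (n + 1 - x) ^ (-s)))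
      (𝓝[>] 1) (𝓝 (1 / (n + x) - 1 / (n + 1 - x))) := by
    intro n
    have hc : Continuous (fun s : ℝ => ((n + x) ^ (-s) - (n + 1 - x) ^ (-s))) :=
      (Real.continuous_const_rpow (hq n).ne' |>.comp continuous_neg).sub
        (Real.continuous_const_rpow (hr n).ne' |>.comp continuous_neg)
    have := (hc.tendsto 1).mono_left (nhdsWithin_le_nhds (s := Set.Ioi 1))
    simpa only [Real.rpow_neg_one, one_div] using this
  have hdom := tendsto_tsum_of_dominated_convergence hsumm hterm
    (hev.mono fun s hs n => abs_rpow_sub_rpow_le hx0 hx1 hs.1 hs.2 n)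
  -- the dominating series also bounds the terms at `s = 1`, as limits
  have hsumm1 : Summable (fun n : ℕ => (1 / (n + x) - 1 / (n + 1 - x))) :=
    Summable.of_norm_bounded hsumm fun n =>
      le_of_tendsto (hterm n).norm
        (hev.mono fun s hs => abs_rpow_sub_rpow_le hx0 hx1 hs.1 hs.2 n)
  rw [tendsto_nhds_unique hsumm1.hasSum.tendsto_sum_nat (tendsto_sum_range_cot hx0 hx1)] at hdom
  have hleft : Tendsto (fun s : ℝ => HurwitzZeta.hurwitzZetaOdd (x : UnitAddCircle) (s : ℂ))
      (𝓝[>] 1) (𝓝 (HurwitzZeta.hurwitzZetaOdd (x : UnitAddCircle) 1)) := by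
    have hc := ((HurwitzZeta.differentiable_hurwitzZetaOdd (x : UnitAddCircle)).continuous.comp
      Complex.continuous_ofReal).tendsto 1
    simp only [Function.comp_def, Complex.ofReal_one] at hc
    exact hc.mono_left nhdsWithin_le_nhds
  refine tendsto_nhds_unique hleft ?_
  have hlim := (Complex.continuous_ofReal.tendsto _).comp (hdom.const_mul (1 / 2))
  rw [show Real.pi / 2 * Real.cot (Real.pi * x) = 1 / 2 * (Real.pi * Real.cot (Real.pi * x)) by
    ring]
  refine hlim.congr' ?_
  filter_upwards [hev] with s hs
  have hS := HurwitzZeta.hasSum_nat_hurwitzZetaOdd_of_mem_Icc (a := x) ⟨hx0.le, hx1.le⟩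
    (s := s) (by simpa using hs.1)
  rw [← hS.tsum_eq, Function.comp_apply, ← tsum_mul_left, Complex.ofReal_tsum]
  refine tsum_congr fun n => ?_
  have e1 : ((n : ℂ) + x) ^ (s : ℂ) = (((n + x) ^ s : ℝ) : ℂ) := by
    rw [Complex.ofReal_cpow (hq n).le]; push_cast; rfl
  have e2 : ((n : ℂ) + 1 - x) ^ (s : ℂ) = (((n + 1 - x) ^ s : ℝ) : ℂ) := by
    rw [Complex.ofReal_cpow (hr n).le]; push_cast; rfl
  rw [e1, e2, Real.rpow_neg (hq n).le, Real.rpow_neg (hr n).le]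
  push_cast
  ring

/-! ### Periodic sine, cotangent and sawtooth functions on `ZMod k` -/

/-- The `k`-periodic function `j ↦ sin (2 π j / k)`. -/
noncomputable def zmodSin {k : ℕ} (j : ZMod k) : ℝ := Real.sin (2 * Real.pi * (j.val / k))

/-- The `k`-periodic function `j ↦ cot (π j / k)`, with value `0` at the pole `j = 0`. -/
noncomputable def zmodCot {k : ℕ} (j : ZMod k) : ℝ := Real.cot (Real.pi * (j.val / k))

/-- The sawtooth function `j ↦ k - 2 j` for `0 < j < k`, with value `0` at the jump `j = 0`. -/
noncomputable def zmodSaw {k : ℕ} (j : ZMod k) : ℝ := if j = 0 then 0 else k - 2 * j.val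

section
variable {k : ℕ}

@[simp] theorem zmodCot_zero : zmodCot (0 : ZMod k) = 0 := by
  simp [zmodCot, Real.cot_eq_cos_div_sin]

theorem abs_zmodSin_le (j : ZMod k) : |zmodSin j| ≤ 1 := Real.abs_sin_le_one _

variable [NeZero k]

theorem zmodSin_intCast (m : ℤ) :
    zmodSin (m : ZMod k) = Real.sin (2 * Real.pi * (m / k)) := by
  have hk : (k : ℝ) ≠ 0 := Nat.cast_ne_zero.2 (NeZero.ne k)
  have h1 : (((m : ZMod k).val : ℤ) : ℝ) = ((m - k * (m / k) : ℤ) : ℝ) := by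
    rw [ZMod.val_intCast, Int.emod_def]
  have h2 : ((m : ZMod k).val : ℝ) = m - k * ((m / k : ℤ) : ℝ) := by exact_mod_cast h1
  rw [zmodSin, h2, ← Real.sin_sub_int_mul_two_pi (2 * Real.pi * (m / k)) (m / k)]
  congr 1
  field_simp

theorem zmodSin_neg (j : ZMod k) : zmodSin (-j) = -zmodSin j := by
  obtain ⟨m, rfl⟩ := ZMod.intCast_surjective j
  rw [← Int.cast_neg, zmodSin_intCast, zmodSin_intCast, ← Real.sin_neg]
  push_cast
  ring_nf

theorem zmodSin_mul (a r : ZMod k) :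
    zmodSin (a * r) = Real.sin (2 * Real.pi * (a.val * r.val / k)) := by
  have h := zmodSin_intCast (k := k) ((a.val : ℤ) * r.val)
  simpa using h

theorem val_div_mem_Ioo {j : ZMod k} (hj : j ≠ 0) :
    0 < (j.val / k : ℝ) ∧ (j.val / k : ℝ) < 1 := by
  have hk : (0 : ℝ) < k := Nat.cast_pos.2 (NeZero.pos k)
  refine ⟨div_pos (Nat.cast_pos.2 (Nat.pos_of_ne_zero ((ZMod.val_ne_zero j).2 hj))) hk,
    (div_lt_one hk).2 (Nat.cast_lt.2 (ZMod.val_lt j))⟩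

theorem val_neg_cast {j : ZMod k} (hj : j ≠ 0) : ((-j).val : ℝ) = k - j.val := by
  have : NeZero j := ⟨hj⟩
  rw [ZMod.val_neg_of_ne_zero, Nat.cast_sub (ZMod.val_lt j).le]

theorem zmodCot_neg (j : ZMod k) : zmodCot (-j) = -zmodCot j := by
  rcases eq_or_ne j 0 with rfl | hj
  · simp
  have hk : (k : ℝ) ≠ 0 := Nat.cast_ne_zero.2 (NeZero.ne k)
  have e : Real.pi * ((k - j.val) / k : ℝ) = Real.pi - Real.pi * (j.val / k) := by
    field_simp
  rw [zmodCot, zmodCot, val_neg_cast hj, e, Real.cot_eq_cos_div_sin, Real.cot_eq_cos_div_sin,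
    Real.cos_pi_sub, Real.sin_pi_sub, neg_div]

theorem sum_odd_eq_zero {g : ZMod k → ℝ} (hg : ∀ j, g (-j) = -g j) : ∑ j, g j = 0 := by
  have h : ∑ j, g j = ∑ j, g (-j) := (Equiv.sum_comp (Equiv.neg (ZMod k)) g).symm
  simp only [hg, Finset.sum_neg_distrib] at h
  linarith

theorem sum_zmod_eq_sum_range {M : Type*} [AddCommMonoid M] (F : ℕ → M) :
    ∑ j : ZMod k, F j.val = ∑ j ∈ Finset.range k, F j := by
  refine Finset.sum_nbij (fun j : ZMod k => j.val) (fun j _ => Finset.mem_range.2 (ZMod.val_lt j))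
    (fun a _ b _ hab => ZMod.val_injective k hab) (fun n hn => ?_) (fun _ _ => rfl)
  have hn' : n < k := by simpa using hn
  exact ⟨(n : ZMod k), Finset.mem_coe.2 (Finset.mem_univ _), ZMod.val_cast_of_lt hn'⟩

theorem sum_range_cast {M : Type*} [AddCommMonoid M] (g : ZMod k → M) :
    ∑ n ∈ Finset.range k, g (n : ZMod k) = ∑ j, g j := by
  rw [← sum_zmod_eq_sum_range (fun n => g (n : ZMod k))]
  simp

/-- Orthogonality of the additive characters of `ZMod k`, real parts. -/
theorem sum_cos_eq (a : ℕ) :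
    ∑ r : ZMod k, Real.cos (2 * Real.pi * (a * r.val / k)) =
      if (a : ZMod k) = 0 then (k : ℝ) else 0 := by
  have h := AddChar.sum_mulShift (a : ZMod k) (ZMod.isPrimitive_stdAddChar k)
  have h' := congrArg Complex.re h
  rw [Complex.re_sum, ZMod.card] at h'
  have e : ∀ r : ZMod k, (ZMod.stdAddChar (r * (a : ZMod k))).re
      = Real.cos (2 * Real.pi * (a * r.val / k)) := by
    intro r
    have h1 : r * (a : ZMod k) = (((a : ℤ) * r.val : ℤ) : ZMod k) := by
      simp [mul_comm]
    rw [h1, ZMod.stdAddChar_apply, ZMod.toCircle_intCast]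
    have h2 : (2 * Real.pi * Complex.I * (((a : ℤ) * r.val : ℤ) : ℂ) / k)
        = ((2 * Real.pi * (a * r.val / k) : ℝ) : ℂ) * Complex.I := by
      push_cast; ring
    rw [h2, Complex.exp_ofReal_mul_I_re]
  simp only [e] at h'
  rw [h']
  split_ifs <;> simp

theorem sum_sin_mul_cot_nat {a : ℕ} (ha : a + 1 < k) :
    ∑ r : ZMod k, Real.sin (2 * Real.pi * ((a + 1 : ℕ) * r.val / k)) * zmodCot r =
      k - 2 * (a + 1 : ℕ) := by
  have hk : (k : ℝ) ≠ 0 := Nat.cast_ne_zero.2 (NeZero.ne k)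
  -- consecutive sums differ by two sums of cosines, apart from the term `r = 0`
  have step : ∀ b : ℕ,
      ∑ r : ZMod k, Real.sin (2 * Real.pi * ((b + 1 : ℕ) * r.val / k)) * zmodCot r
      = ∑ r : ZMod k, Real.sin (2 * Real.pi * (b * r.val / k)) * zmodCot r
        + ((∑ r : ZMod k, Real.cos (2 * Real.pi * ((b + 1 : ℕ) * r.val / k)))
          + (∑ r : ZMod k, Real.cos (2 * Real.pi * (b * r.val / k))) - 2) := by
    intro b
    have e2 : (2 : ℝ) = ∑ r : ZMod k, if r = 0 then (2 : ℝ) else 0 := by simp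
    rw [e2, ← Finset.sum_add_distrib, ← Finset.sum_sub_distrib, ← Finset.sum_add_distrib, ← e2]
    refine Finset.sum_congr rfl fun r _ => ?_
    rcases eq_or_ne r 0 with rfl | hr
    · simp; norm_num
    rw [if_neg hr]
    obtain ⟨h0, h1⟩ := val_div_mem_Ioo hr
    set y := Real.pi * (r.val / k : ℝ) with hy
    have hs : Real.sin y ≠ 0 := by
      refine (Real.sin_pos_of_pos_of_lt_pi (by positivity) ?_).ne'
      rw [hy]; nlinarith [Real.pi_pos]
    have ec : zmodCot r = Real.cos y / Real.sin y := by
      rw [zmodCot, Real.cot_eq_cos_div_sin]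
    set z := 2 * Real.pi * (b * r.val / k : ℝ) with hz
    have ez : 2 * Real.pi * ((b + 1 : ℕ) * r.val / k : ℝ) = z + 2 * y := by
      rw [hz, hy]; push_cast; ring
    rw [ez, ec, Real.sin_add, Real.cos_add, Real.sin_two_mul, Real.cos_two_mul]
    field_simp
    have := Real.sin_sq_add_cos_sq y
    have e3 : Real.cos y ^ 2 = 1 - Real.sin y ^ 2 := by linarith
    have e4 : Real.cos y ^ 3 = Real.cos y * (1 - Real.sin y ^ 2) := by rw [← e3]; ring
    ring_nf
    simp only [e3, e4]
    ring
  have hnz : ∀ b : ℕ, b + 1 < k → ((b + 1 : ℕ) : ZMod k) ≠ 0 := by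
    intro b hb h
    rw [ZMod.natCast_eq_zero_iff] at h
    exact absurd (Nat.le_of_dvd (Nat.succ_pos b) h) (by omega)
  induction a with
  | zero =>
    rw [step, sum_cos_eq, sum_cos_eq, if_neg (hnz 0 ha)]
    simp
  | succ a ih =>
    rw [step, ih (by omega), sum_cos_eq, sum_cos_eq, if_neg (hnz (a + 1) ha),
      if_neg (hnz a (by omega))]
    push_cast
    ring

/-- Eisenstein's formula: the cotangent is the finite sine transform of the sawtooth. -/
theorem sum_zmodSin_mul_zmodCot (a : ZMod k) :
    ∑ r, zmodSin (a * r) * zmodCot r = zmodSaw a := by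
  simp only [zmodSin_mul]
  rcases eq_or_ne a 0 with rfl | ha
  · simp [zmodSaw]
  obtain ⟨b, hb⟩ := Nat.exists_eq_succ_of_ne_zero ((ZMod.val_ne_zero a).2 ha)
  have h := sum_sin_mul_cot_nat (k := k) (a := b) (by
    have := ZMod.val_lt a
    omega)
  rw [zmodSaw, if_neg ha, hb]
  exact h

/-! ### The Vasyunin sum as a sum over `ZMod k` -/

theorem vasyuninSum_eq_sum_zmod (p : ℤ) :
    vasyuninSum p k = ∑ j : ZMod k, ((j * (p : ZMod k)).val / k : ℝ) * zmodCot j := by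
  have h := sum_zmod_eq_sum_range (k := k) (fun n : ℕ => Int.fract ((n : ℝ) * (p : ℝ) / (k : ℝ)) *
    Real.cot ((n : ℝ) * Real.pi / (k : ℝ)))
  rw [Finset.range_eq_Ico, Finset.sum_eq_sum_Ico_succ_bot (NeZero.pos k), Nat.cast_zero, zero_mul,
    zero_div, Int.fract_zero, zero_mul, zero_add, zero_add] at h
  rw [vasyuninSum, ← h]
  refine Finset.sum_congr rfl fun j _ => ?_
  have e1 : ((j.val : ℝ) * (p : ℝ) / (k : ℝ)) = ((j.val * p : ℤ) : ℝ) / k := by push_cast; rfl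
  have e2 : ((j * (p : ZMod k)).val : ℤ) = (j.val * p : ℤ) % k := by
    rw [← ZMod.val_intCast]; simp
  rw [e1, Int.fract_div_intCast_eq_div_intCast_mod, ← e2, Int.cast_natCast, zmodCot]
  congr 2
  ring

/-- The sawtooth `k - 2 j` and the fractional part `j / k` differ by an affine change that the
oddness of the cotangent makes harmless. -/
theorem sum_zmodSaw_mul_zmodCot {p : ℤ} (hp : IsUnit (p : ZMod k)) :
    ∑ j : ZMod k, zmodSaw (j * (p : ZMod k)) * zmodCot j = -(2 * k) * vasyuninSum p k := by
  have hk : (k : ℝ) ≠ 0 := Nat.cast_ne_zero.2 (NeZero.ne k)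
  have h0 : ∑ j : ZMod k, zmodCot j = 0 := sum_odd_eq_zero zmodCot_neg
  have : ∀ j : ZMod k, zmodSaw (j * (p : ZMod k)) * zmodCot j =
      k * zmodCot j + -(2 * k) * (((j * (p : ZMod k)).val / k : ℝ) * zmodCot j) := by
    intro j
    rcases eq_or_ne j 0 with rfl | hj
    · simp
    rw [zmodSaw, if_neg (mt hp.mul_left_eq_zero.1 hj)]
    field_simp
    ring
  simp only [this]
  rw [Finset.sum_add_distrib, ← Finset.mul_sum, ← Finset.mul_sum, h0, vasyuninSum_eq_sum_zmod]
  ring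

end

/-! ### Values of the odd Hurwitz and sine zeta functions at rational points -/

section
variable {k : ℕ} [NeZero k]

open HurwitzZeta ZMod

/-- At `j = 0` both sides vanish, the left one by oddness. -/
theorem hurwitzZetaOdd_toAddCircle_one (j : ZMod k) :
    hurwitzZetaOdd (toAddCircle j) 1 = ((Real.pi / 2 * zmodCot j : ℝ) : ℂ) := by
  rcases eq_or_ne j 0 with rfl | hj
  · have h := hurwitzZetaOdd_neg 0 1
    rw [neg_zero, self_eq_neg] at h
    simp [h]
  · obtain ⟨h0, h1⟩ := val_div_mem_Ioo hj
    rw [toAddCircle_apply, hurwitzZetaOdd_one h0 h1, zmodCot]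

theorem LSeriesHasSum_zmodSin (a : ZMod k) {s : ℂ} (hs : 1 < s.re) :
    LSeriesHasSum (fun n => (zmodSin (a * (n : ZMod k)) : ℂ)) s (sinZeta (toAddCircle a) s) := by
  rw [toAddCircle_apply]
  refine (LSeriesHasSum_congr s _ fun {n} _ => ?_).1 (LSeriesHasSum_sin (a.val / k : ℝ) hs)
  have h := zmodSin_intCast (k := k) ((a.val : ℤ) * n)
  have e : (((a.val : ℤ) * n : ℤ) : ZMod k) = a * (n : ZMod k) := by simp
  rw [← e, h]
  push_cast
  ring_nf

/-- The sine zeta function at a rational point is a finite sine transform of odd Hurwitz zeta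
functions, since its coefficients are odd and periodic. -/
theorem sinZeta_toAddCircle (a : ZMod k) (s : ℂ) :
    sinZeta (toAddCircle a) s =
      (k : ℂ) ^ (-s) * ∑ r : ZMod k, zmodSin (a * r) * hurwitzZetaOdd (toAddCircle r) s := by
  have hodd : Function.Odd (fun j : ZMod k => (zmodSin (a * j) : ℂ)) := by
    intro j
    simp only [mul_neg, zmodSin_neg, Complex.ofReal_neg]
  have h0 : ∑ j : ZMod k, (zmodSin (a * j) : ℂ) = 0 := by
    rw [← Complex.ofReal_sum, sum_odd_eq_zero fun j => by rw [mul_neg, zmodSin_neg],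
      Complex.ofReal_zero]
  have hL : IsEntireContinuation (fun n => (zmodSin (a * (n : ZMod k)) : ℂ))
      (LFunction (fun j : ZMod k => (zmodSin (a * j) : ℂ))) := by
    refine ⟨differentiable_LFunction_of_sum_zero h0, fun s hs => ?_⟩
    rw [LFunction_eq_LSeries _ hs]
    exact (LSeriesSummable_of_one_lt_re (fun j : ZMod k => (zmodSin (a * j) : ℂ)) hs).LSeriesHasSum
  have hS : IsEntireContinuation (fun n => (zmodSin (a * (n : ZMod k)) : ℂ))
      (sinZeta (toAddCircle a)) :=
    ⟨differentiableAt_sinZeta _, fun s hs => LSeriesHasSum_zmodSin a hs⟩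
  rw [hS.unique hL, LFunction_def_odd hodd]

theorem sinZeta_toAddCircle_one (a : ZMod k) :
    sinZeta (toAddCircle a) 1 = ((Real.pi / (2 * k) * zmodSaw a : ℝ) : ℂ) := by
  rw [sinZeta_toAddCircle, Complex.cpow_neg_one, ← sum_zmodSin_mul_zmodCot]
  simp only [hurwitzZetaOdd_toAddCircle_one]
  push_cast
  rw [Finset.mul_sum, Finset.mul_sum]
  refine Finset.sum_congr rfl fun r _ => ?_
  ring

/-- The functional equation at `s = 1`. -/
theorem hurwitzZetaOdd_zero_eq (x : UnitAddCircle) :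
    hurwitzZetaOdd x 0 = sinZeta x 1 / Real.pi := by
  have h := hurwitzZetaOdd_one_sub x (s := 1) (fun n hn => by
    have : ((n + 1 : ℕ) : ℂ) = 0 := by push_cast; rw [hn]; ring
    exact Nat.cast_ne_zero.2 n.succ_ne_zero this)
  have hpi : (Real.pi : ℂ) ≠ 0 := Complex.ofReal_ne_zero.2 Real.pi_ne_zero
  rw [sub_self, Complex.cpow_neg_one, Complex.Gamma_one, mul_one, mul_one,
    Complex.sin_pi_div_two] at h
  rw [h]
  field_simp

/-- The functional equation at `s = 1`, with the two zeta functions interchanged. -/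
theorem sinZeta_zero_eq (x : UnitAddCircle) :
    sinZeta x 0 = hurwitzZetaOdd x 1 / Real.pi := by
  have h := sinZeta_one_sub x (s := 1) (fun n hn => by
    have : ((n + 1 : ℕ) : ℂ) = 0 := by push_cast; rw [hn]; ring
    exact Nat.cast_ne_zero.2 n.succ_ne_zero this)
  have hpi : (Real.pi : ℂ) ≠ 0 := Complex.ofReal_ne_zero.2 Real.pi_ne_zero
  rw [sub_self, Complex.cpow_neg_one, Complex.Gamma_one, mul_one, mul_one,
    Complex.sin_pi_div_two] at h
  rw [h]
  field_simp

theorem hurwitzZetaOdd_toAddCircle_zero (a : ZMod k) :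
    hurwitzZetaOdd (toAddCircle a) 0 = ((zmodSaw a / (2 * k) : ℝ) : ℂ) := by
  have hpi : (Real.pi : ℂ) ≠ 0 := Complex.ofReal_ne_zero.2 Real.pi_ne_zero
  rw [hurwitzZetaOdd_zero_eq, sinZeta_toAddCircle_one]
  push_cast
  field_simp

theorem sinZeta_toAddCircle_zero (a : ZMod k) :
    sinZeta (toAddCircle a) 0 = ((zmodCot a / 2 : ℝ) : ℂ) := by
  have hpi : (Real.pi : ℂ) ≠ 0 := Complex.ofReal_ne_zero.2 Real.pi_ne_zero
  rw [sinZeta_zero_eq, hurwitzZetaOdd_toAddCircle_one]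
  push_cast
  field_simp

/-! ### The continuation of the Dirichlet series -/

/-- The finite bilinear expression in odd Hurwitz and sine zeta functions that continues the
Dirichlet series with coefficients `τ(n) sin (2 π n h / k)`. -/
noncomputable def esinEntire (h : ZMod k) (s : ℂ) : ℂ :=
  (k : ℂ) ^ (-s) *
    ∑ r : ZMod k, hurwitzZetaOdd (toAddCircle r) s * sinZeta (toAddCircle (h * r)) s

theorem differentiable_esinEntire (h : ZMod k) : Differentiable ℂ (esinEntire h) := by
  have hk : (k : ℂ) ≠ 0 := Nat.cast_ne_zero.2 (NeZero.ne k)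
  refine Differentiable.mul ?_ (Differentiable.fun_sum fun r _ =>
    (differentiable_hurwitzZetaOdd _).mul (differentiableAt_sinZeta _))
  exact differentiable_id.neg.const_cpow (Or.inl hk)

theorem esinCoeff_eq (h : ℤ) (n : ℕ) :
    esinCoeff h k n = (n.divisors.card : ℝ) * zmodSin ((h : ZMod k) * (n : ZMod k)) := by
  have e := zmodSin_intCast (k := k) (h * n)
  rw [Int.cast_mul, Int.cast_natCast] at e
  rw [esinCoeff, e]
  push_cast
  ring_nf

/-- The odd part of the indicator function of the residue class `r`, doubled. -/
noncomputable def oddIndicator (r j : ZMod k) : ℂ :=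
  (if j = r then 1 else 0) - (if j = -r then 1 else 0)

theorem LSeriesHasSum_oddIndicator (r : ZMod k) {s : ℂ} (hs : 1 < s.re) :
    LSeriesHasSum (fun n => oddIndicator r (n : ZMod k)) s
      ((k : ℂ) ^ (-s) * (2 * hurwitzZetaOdd (toAddCircle r) s)) := by
  have hodd : Function.Odd (oddIndicator r) := by
    intro j
    simp only [oddIndicator, neg_eq_iff_eq_neg, neg_neg, neg_sub]
  have e : LFunction (oddIndicator r) s =
      (k : ℂ) ^ (-s) * (2 * hurwitzZetaOdd (toAddCircle r) s) := by
    rw [LFunction_def_odd hodd]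
    simp only [oddIndicator, sub_mul, ite_mul, one_mul, zero_mul, Finset.sum_sub_distrib,
      Finset.sum_ite_eq', Finset.mem_univ, if_true, map_neg, hurwitzZetaOdd_neg]
    ring
  rw [← e, LFunction_eq_LSeries _ hs]
  exact (LSeriesSummable_of_one_lt_re _ hs).LSeriesHasSum

/-- Sorting the factorizations `n = a b` by the residue class `r` of `a` turns the coefficients
into a finite sum of Dirichlet convolutions. As the sine is odd, the indicator function of the
class may be replaced by its odd part, which makes all the L-functions involved entire. -/
theorem esinCoeff_eq_sum_convolution (h : ℤ) (n : ℕ) :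
    (esinCoeff h k n : ℂ) = ∑ r : ZMod k, (1 / 2) *
      LSeries.convolution (fun n => oddIndicator r (n : ZMod k))
        (fun n => (zmodSin ((h : ZMod k) * r * (n : ZMod k)) : ℂ)) n := by
  rw [← Finset.mul_sum]
  simp only [LSeries.convolution_def]
  rw [Finset.sum_comm]
  have : ∀ p ∈ n.divisorsAntidiagonal, ∑ r : ZMod k, oddIndicator r (p.1 : ZMod k) *
      (zmodSin ((h : ZMod k) * r * (p.2 : ZMod k)) : ℂ) =
      2 * (zmodSin ((h : ZMod k) * (n : ZMod k)) : ℂ) := by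
    intro p hp
    have hn : (n : ZMod k) = p.1 * p.2 := by
      rw [← Nat.cast_mul, (Nat.mem_divisorsAntidiagonal.1 hp).1]
    have e : ∀ r : ZMod k, ((p.1 : ZMod k) = -r) ↔ -(p.1 : ZMod k) = r := fun r =>
      neg_eq_iff_eq_neg.symm
    simp only [oddIndicator, sub_mul, ite_mul, one_mul, zero_mul, Finset.sum_sub_distrib, e,
      Finset.sum_ite_eq, Finset.mem_univ, if_true]
    rw [mul_neg, neg_mul, zmodSin_neg, hn, mul_assoc]
    push_cast
    ring
  rw [Finset.sum_congr rfl this, Finset.sum_const, esinCoeff_eq, ← Nat.map_div_right_divisors,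
    Finset.card_map,
    nsmul_eq_mul]
  push_cast
  ring

theorem isEntireContinuation_esinEntire (h : ℤ) :
    IsEntireContinuation (fun n => (esinCoeff h k n : ℂ)) (esinEntire (h : ZMod k)) := by
  refine ⟨differentiable_esinEntire _, fun s hs => ?_⟩
  have hr : ∀ r ∈ (Finset.univ : Finset (ZMod k)), LSeriesHasSum ((1 / 2 : ℂ) •
      LSeries.convolution (fun n => oddIndicator r (n : ZMod k))
        (fun n => (zmodSin ((h : ZMod k) * r * (n : ZMod k)) : ℂ))) s
      ((1 / 2) * ((k : ℂ) ^ (-s) * (2 * hurwitzZetaOdd (toAddCircle r) s) *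
        sinZeta (toAddCircle ((h : ZMod k) * r)) s)) := fun r _ =>
    ((LSeriesHasSum_oddIndicator r hs).convolution (LSeriesHasSum_zmodSin _ hs)).smul _
  have h1 := LSeriesHasSum.sum hr
  have e : ∑ r : ZMod k, ((1 / 2) * ((k : ℂ) ^ (-s) * (2 * hurwitzZetaOdd (toAddCircle r) s) *
        sinZeta (toAddCircle ((h : ZMod k) * r)) s)) = esinEntire (h : ZMod k) s := by
    rw [esinEntire, Finset.mul_sum]
    refine Finset.sum_congr rfl fun r _ => ?_
    ring
  rw [e] at h1
  refine (LSeriesHasSum_congr s _ fun {n} _ => ?_).1 h1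
  rw [esinCoeff_eq_sum_convolution, Finset.sum_apply]
  rfl

theorem esinEntire_one {p : ℤ} (hp : IsUnit (p : ZMod k)) :
    esinEntire (p : ZMod k) 1 = ((-(Real.pi ^ 2 / (2 * k)) * vasyuninSum p k : ℝ) : ℂ) := by
  have hk : (k : ℝ) ≠ 0 := Nat.cast_ne_zero.2 (NeZero.ne k)
  have e : -(Real.pi ^ 2 / (2 * k)) * vasyuninSum p k =
      (k : ℝ)⁻¹ * ∑ r : ZMod k, (Real.pi / 2 * zmodCot r) *
        (Real.pi / (2 * k) * zmodSaw ((p : ZMod k) * r)) := by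
    have h := sum_zmodSaw_mul_zmodCot hp
    have e1 : ∀ r : ZMod k, (Real.pi / 2 * zmodCot r) *
        (Real.pi / (2 * k) * zmodSaw ((p : ZMod k) * r)) =
        Real.pi ^ 2 / (4 * k) * (zmodSaw (r * (p : ZMod k)) * zmodCot r) := by
      intro r
      rw [mul_comm (p : ZMod k) r]
      field_simp
      ring
    simp only [e1]
    rw [← Finset.mul_sum, h]
    field_simp
    ring
  rw [e, esinEntire, Complex.cpow_neg_one]
  simp only [hurwitzZetaOdd_toAddCircle_one, sinZeta_toAddCircle_one]
  push_cast
  rfl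

theorem esinEntire_zero {p q : ℤ} (hpq : (p : ZMod k) * (q : ZMod k) = 1) :
    esinEntire (p : ZMod k) 0 = ((-(1 / 2) * vasyuninSum q k : ℝ) : ℂ) := by
  have hk : (k : ℝ) ≠ 0 := Nat.cast_ne_zero.2 (NeZero.ne k)
  have hqp : (q : ZMod k) * (p : ZMod k) = 1 := by rw [mul_comm, hpq]
  have hq : IsUnit (q : ZMod k) := IsUnit.of_mul_eq_one _ hqp
  have e : -(1 / 2) * vasyuninSum q k =
      ∑ r : ZMod k, (zmodSaw r / (2 * k)) * (zmodCot ((p : ZMod k) * r) / 2) := by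
    have h := sum_zmodSaw_mul_zmodCot hq
    -- substitute `r = q j`, a permutation of the residue classes
    rw [← Equiv.sum_comp (hq.unit.mulLeft)]
    have e1 : ∀ j : ZMod k, (zmodSaw (hq.unit.mulLeft j) / (2 * k)) *
        (zmodCot ((p : ZMod k) * hq.unit.mulLeft j) / 2) =
        1 / (4 * k) * (zmodSaw (j * (q : ZMod k)) * zmodCot j) := by
      intro j
      simp only [Units.mulLeft_apply, IsUnit.unit_spec]
      rw [← mul_assoc, hpq, one_mul, mul_comm (q : ZMod k) j]
      field_simp
      ring
    simp only [e1]
    rw [← Finset.mul_sum, h]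
    field_simp
    ring
  rw [e, esinEntire, neg_zero, Complex.cpow_zero, one_mul]
  simp only [hurwitzZetaOdd_toAddCircle_zero, sinZeta_toAddCircle_zero]
  push_cast
  rfl

end

/-! ### Series with odd periodic coefficients -/

/-- Partial summation: a sequence with partial sums bounded by `B` gives tails of `∑ g n / n`
of size `O(B / M)`. -/
theorem abs_sum_Ico_div_le {g : ℕ → ℝ} {B : ℝ}
    (hB : ∀ N, |∑ n ∈ Finset.range N, g n| ≤ B) {M N : ℕ} (hMN : M ≤ N) :
    |∑ n ∈ Finset.Ico (M + 1) (N + 1), g n / n| ≤ 4 * B / (M + 1) := by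
  have hB0 : 0 ≤ B := (abs_nonneg _).trans (hB 0)
  have hH : ∀ N, M ≤ N → |∑ n ∈ Finset.Ico (M + 1) (N + 1), g n| ≤ 2 * B := by
    intro N hN
    rw [Finset.sum_Ico_eq_sub _ (by omega)]
    exact (abs_sub _ _).trans (by linarith [hB (N + 1), hB (M + 1)])
  -- with the boundary term subtracted, the bound telescopes
  have key : |∑ n ∈ Finset.Ico (M + 1) (N + 1), g n / n -
      (∑ n ∈ Finset.Ico (M + 1) (N + 1), g n) / (N + 1)| ≤
      2 * B * (1 / (M + 1) - 1 / (N + 1)) := by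
    induction N, hMN using Nat.le_induction with
    | base => simp
    | succ N hN ih =>
      have hHN := hH (N + 1) (by omega)
      have hle : M + 1 ≤ N + 1 := by omega
      rw [Finset.sum_Ico_succ_top hle] at hHN
      rw [Finset.sum_Ico_succ_top hle, Finset.sum_Ico_succ_top hle]
      set S := ∑ n ∈ Finset.Ico (M + 1) (N + 1), g n / n
      set H := ∑ n ∈ Finset.Ico (M + 1) (N + 1), g n
      have hd : 0 ≤ 1 / ((N : ℝ) + 1) - 1 / (N + 2) :=
        sub_nonneg.2 (one_div_le_one_div_of_le (by positivity) (by linarith))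
      have e : S + g (N + 1) / ((N + 1 : ℕ) : ℝ) - (H + g (N + 1)) / (((N + 1 : ℕ) : ℝ) + 1) =
          (S - H / (N + 1)) + (H + g (N + 1)) * (1 / ((N : ℝ) + 1) - 1 / (N + 2)) := by
        have h1 : (N : ℝ) + 1 ≠ 0 := by positivity
        have h2 : (N : ℝ) + 2 ≠ 0 := by positivity
        push_cast
        rw [show (N : ℝ) + 1 + 1 = N + 2 by ring]
        field_simp
        ring
      rw [e]
      refine (abs_add_le _ _).trans ?_
      rw [abs_mul, abs_of_nonneg hd]
      have := mul_le_mul_of_nonneg_right hHN hd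
      push_cast
      rw [show (N : ℝ) + 1 + 1 = N + 2 by ring]
      linarith
  have hlast : |(∑ n ∈ Finset.Ico (M + 1) (N + 1), g n) / ((N : ℝ) + 1)| ≤ 2 * B / (N + 1) := by
    rw [abs_div, abs_of_pos (by positivity : (0 : ℝ) < N + 1)]
    exact div_le_div_of_nonneg_right (hH N hMN) (by positivity)
  have h3 := abs_add_le (∑ n ∈ Finset.Ico (M + 1) (N + 1), g n / n -
      (∑ n ∈ Finset.Ico (M + 1) (N + 1), g n) / (N + 1))
      ((∑ n ∈ Finset.Ico (M + 1) (N + 1), g n) / (N + 1))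
  rw [sub_add_cancel] at h3
  have h4 : 0 ≤ 2 * B / ((M : ℝ) + 1) := by positivity
  have e4 : 2 * B * (1 / ((M : ℝ) + 1) - 1 / (N + 1)) = 2 * B / (M + 1) - 2 * B / (N + 1) := by
    ring
  have e5 : 4 * B / ((M : ℝ) + 1) = 2 * B / (M + 1) + 2 * B / (M + 1) := by ring
  linarith

section
variable {k : ℕ} [NeZero k]

theorem abs_sum_range_odd_le {g : ZMod k → ℝ} (hg : ∀ j, g (-j) = -g j) (h1 : ∀ j, |g j| ≤ 1)
    (N : ℕ) : |∑ n ∈ Finset.range N, g (n : ZMod k)| ≤ k := by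
  induction N using Nat.strong_induction_on with
  | _ N ih =>
    rcases lt_or_ge N k with hN | hN
    · calc _ ≤ ∑ n ∈ Finset.range N, |g (n : ZMod k)| := Finset.abs_sum_le_sum_abs _ _
        _ ≤ ∑ n ∈ Finset.range N, (1 : ℝ) := Finset.sum_le_sum fun n _ => h1 _
        _ ≤ k := by simpa using hN.le
    · obtain ⟨N, rfl⟩ := Nat.exists_eq_add_of_le hN
      rw [Finset.sum_range_add]
      simp only [Nat.cast_add, CharP.cast_eq_zero, zero_add]
      rw [sum_range_cast, sum_odd_eq_zero hg, zero_add]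
      exact ih N (by have := NeZero.pos k; omega)

/-- Sum of `g(n) / n` over a block of one period, symmetrized by `r ↦ -r`. -/
theorem sum_block_odd_div {g : ZMod k → ℝ} (hg : ∀ j, g (-j) = -g j) (m : ℕ) :
    ∑ r ∈ Finset.range k, g (((k * m + r : ℕ)) : ZMod k) / ((k * m + r : ℕ) : ℝ) =
      1 / (2 * k) * ∑ j : ZMod k, g j *
        (1 / (m + (j.val / k : ℝ)) - 1 / (m + 1 - (j.val / k : ℝ))) := by
  have hk : (0 : ℝ) < k := Nat.cast_pos.2 (NeZero.pos k)
  have hg0 : g 0 = 0 := by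
    have := hg 0
    rw [neg_zero] at this
    linarith
  have h1 : ∑ r ∈ Finset.range k, g (((k * m + r : ℕ)) : ZMod k) / ((k * m + r : ℕ) : ℝ) =
      ∑ j : ZMod k, g j / (k * m + j.val) := by
    have := sum_zmod_eq_sum_range (k := k)
      (fun r : ℕ => g (((k * m + r : ℕ)) : ZMod k) / ((k * m + r : ℕ) : ℝ))
    rw [← this]
    refine Finset.sum_congr rfl fun j _ => ?_
    simp
  have h2 : ∑ j : ZMod k, g j / (k * m + j.val) = ∑ j : ZMod k, g (-j) / (k * m + (-j).val) :=
    (Equiv.sum_comp (Equiv.neg (ZMod k)) (fun j => g j / (k * m + j.val))).symm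
  have h3 : ∑ j : ZMod k, g j / (k * m + j.val) =
      1 / 2 * ∑ j : ZMod k, (g j / (k * m + j.val) + g (-j) / (k * m + (-j).val)) := by
    rw [Finset.sum_add_distrib, ← h2]
    ring
  rw [h1, h3, Finset.mul_sum, Finset.mul_sum]
  refine Finset.sum_congr rfl fun j _ => ?_
  rcases eq_or_ne j 0 with rfl | hj
  · simp [hg0]
  obtain ⟨hv0, hv1⟩ := val_div_mem_Ioo hj
  have hm : (0 : ℝ) ≤ m := m.cast_nonneg
  have ev : ((j.val : ℝ)) = k * (j.val / k : ℝ) := by field_simp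
  rw [hg, val_neg_cast hj]
  generalize hx : (j.val / k : ℝ) = x at *
  rw [ev, show (k * m + k * x : ℝ) = k * (m + x) by ring,
    show (k * m + (k - k * x) : ℝ) = k * (m + 1 - x) by ring]
  have p1 : (m : ℝ) + x ≠ 0 := by positivity
  have p2 : (m : ℝ) + 1 - x ≠ 0 := by linarith
  field_simp
  ring

/-- A series `∑ g(n) / n` with odd periodic coefficients converges to a finite cotangent sum, with
error `O(1 / M)` uniform in `g`. -/
theorem abs_sum_range_odd_div_sub_le {g : ZMod k → ℝ} (hg : ∀ j, g (-j) = -g j)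
    (h1 : ∀ j, |g j| ≤ 1) (M : ℕ) :
    |∑ n ∈ Finset.range (M + 1), g (n : ZMod k) / n -
      Real.pi / (2 * k) * ∑ j, g j * zmodCot j| ≤ 4 * k / (M + 1) := by
  have hk : (0 : ℝ) < k := Nat.cast_pos.2 (NeZero.pos k)
  have hg0 : g 0 = 0 := by
    have := hg 0
    rw [neg_zero] at this
    linarith
  -- along multiples of `k` the partial sums are, period by period, those of the cotangent series
  have hlim : Tendsto (fun m : ℕ => ∑ n ∈ Finset.range (k * m), g (n : ZMod k) / n) atTop
      (𝓝 (Real.pi / (2 * k) * ∑ j, g j * zmodCot j)) := by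
    have e : ∀ m : ℕ, ∑ n ∈ Finset.range (k * m), g (n : ZMod k) / n =
        1 / (2 * k) * ∑ j : ZMod k, g j * ∑ i ∈ Finset.range m,
          (1 / (i + (j.val / k : ℝ)) - 1 / (i + 1 - (j.val / k : ℝ))) := by
      intro m
      induction m with
      | zero => simp
      | succ m ih =>
        rw [Nat.mul_succ, Finset.sum_range_add, ih, sum_block_odd_div hg]
        simp only [Finset.sum_range_succ, mul_add, Finset.sum_add_distrib]
    have h := (tendsto_finsetSum (Finset.univ : Finset (ZMod k)) (fun j _ => show
      Tendsto (fun m : ℕ => g j * ∑ i ∈ Finset.range m,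
          (1 / (i + (j.val / k : ℝ)) - 1 / (i + 1 - (j.val / k : ℝ)))) atTop
        (𝓝 (g j * (Real.pi * zmodCot j))) from by
        rcases eq_or_ne j 0 with rfl | hj
        · simp [hg0]
        · obtain ⟨hv0, hv1⟩ := val_div_mem_Ioo hj
          exact (tendsto_sum_range_cot hv0 hv1).const_mul _)).const_mul (1 / (2 * (k : ℝ)))
    have e2 : Real.pi / (2 * k) * ∑ j, g j * zmodCot j =
        1 / (2 * k) * ∑ j : ZMod k, g j * (Real.pi * zmodCot j) := by
      rw [Finset.mul_sum, Finset.mul_sum]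
      refine Finset.sum_congr rfl fun j _ => ?_
      ring
    rw [e2]
    exact h.congr fun m => (e m).symm
  refine le_of_tendsto ((hlim.const_sub _).abs) ?_
  filter_upwards [eventually_ge_atTop (M + 1)] with m hm
  have hkm : M + 1 ≤ k * m := hm.trans (Nat.le_mul_of_pos_left m (NeZero.pos k))
  obtain ⟨N, hN⟩ := Nat.exists_eq_add_of_le hkm
  rw [hN, abs_sub_comm, ← Finset.sum_Ico_eq_sub _ (by omega),
    show M + 1 + N = (M + N) + 1 by ring]
  exact abs_sum_Ico_div_le (abs_sum_range_odd_le hg h1) (Nat.le_add_right M N)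

/-! ### The hyperbola method -/

/-- Dirichlet's hyperbola method for a symmetric summand: every pair of positive integers with
product at most `N` has a component at most `√N`. -/
theorem sum_divisorsAntidiagonal_eq_hyperbola {F : ℕ → ℕ → ℝ} (hF : ∀ a b, F a b = F b a) (N : ℕ) :
    ∑ n ∈ Finset.Icc 1 N, ∑ p ∈ n.divisorsAntidiagonal, F p.1 p.2 =
      2 * ∑ a ∈ Finset.Icc 1 N.sqrt, ∑ b ∈ Finset.Icc 1 (N / a), F a b -
        ∑ a ∈ Finset.Icc 1 N.sqrt, ∑ b ∈ Finset.Icc 1 N.sqrt, F a b := by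
  classical
  set Q := N.sqrt with hQ
  let T : Finset (ℕ × ℕ) := (Finset.Icc 1 N ×ˢ Finset.Icc 1 N).filter fun p => p.1 * p.2 ≤ N
  have hT : ∀ p : ℕ × ℕ, p ∈ T ↔ 1 ≤ p.1 ∧ 1 ≤ p.2 ∧ p.1 * p.2 ≤ N := by
    intro p
    simp only [T, Finset.mem_filter, Finset.mem_product, Finset.mem_Icc]
    constructor
    · rintro ⟨⟨⟨h1, -⟩, h2, -⟩, h3⟩
      exact ⟨h1, h2, h3⟩
    · rintro ⟨h1, h2, h3⟩
      exact ⟨⟨⟨h1, (Nat.le_mul_of_pos_right _ h2).trans h3⟩, h2,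
        (Nat.le_mul_of_pos_left _ h1).trans h3⟩, h3⟩
  have hQle : ∀ a b : ℕ, a ≤ Q → b ≤ Q → a * b ≤ N := fun a b ha hb =>
    (Nat.mul_le_mul ha hb).trans (Nat.sqrt_le N)
  have hQlt : ∀ a b : ℕ, Q < a → Q < b → N < a * b := fun a b ha hb =>
    (Nat.lt_succ_sqrt N).trans_le (Nat.mul_le_mul ha hb)
  have hleft : ∑ n ∈ Finset.Icc 1 N, ∑ p ∈ n.divisorsAntidiagonal, F p.1 p.2 =
      ∑ p ∈ T, F p.1 p.2 := by
    rw [← Finset.sum_fiberwise_of_maps_to (s := T) (t := Finset.Icc 1 N)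
      (g := fun p : ℕ × ℕ => p.1 * p.2)]
    · refine Finset.sum_congr rfl fun n hn => Finset.sum_congr ?_ fun _ _ => rfl
      ext p
      rw [Finset.mem_filter, hT, Nat.mem_divisorsAntidiagonal]
      rw [Finset.mem_Icc] at hn
      constructor
      · rintro ⟨rfl, h⟩
        exact ⟨⟨Nat.pos_of_ne_zero fun h0 => h (by simp [h0]),
          Nat.pos_of_ne_zero fun h0 => h (by simp [h0]), hn.2⟩, rfl⟩
      · rintro ⟨-, rfl⟩
        exact ⟨rfl, by omega⟩
    · intro p hp
      rw [hT] at hp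
      exact Finset.mem_Icc.2 ⟨Nat.mul_pos hp.1 hp.2.1, hp.2.2⟩
  have hA : ∑ p ∈ T with p.1 ≤ Q, F p.1 p.2 =
      ∑ a ∈ Finset.Icc 1 Q, ∑ b ∈ Finset.Icc 1 (N / a), F a b := by
    rw [Finset.sum_sigma']
    refine Finset.sum_nbij' (fun p => ⟨p.1, p.2⟩) (fun x => (x.1, x.2)) ?_ ?_ ?_ ?_ ?_
    · intro p hp
      rw [Finset.mem_filter, hT] at hp
      simp only [Finset.mem_sigma, Finset.mem_Icc]
      exact ⟨⟨hp.1.1, hp.2⟩, hp.1.2.1, (Nat.le_div_iff_mul_le hp.1.1).2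
        (by rw [mul_comm]; exact hp.1.2.2)⟩
    · intro x hx
      simp only [Finset.mem_sigma, Finset.mem_Icc] at hx
      rw [Finset.mem_filter, hT]
      exact ⟨⟨hx.1.1, hx.2.1, by
        have := (Nat.le_div_iff_mul_le hx.1.1).1 hx.2.2
        rwa [mul_comm] at this⟩, hx.1.2⟩
    · intros; rfl
    · intros; rfl
    · intros; rfl
  have hB : ∑ p ∈ T with ¬ p.1 ≤ Q, F p.1 p.2 =
      ∑ p ∈ T with p.1 ≤ Q, F p.1 p.2 - ∑ p ∈ T with (p.1 ≤ Q ∧ p.2 ≤ Q), F p.1 p.2 := by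
    rw [eq_sub_iff_add_eq]
    have hswap : ∑ p ∈ T with p.1 ≤ Q, F p.1 p.2 = ∑ p ∈ T with p.2 ≤ Q, F p.1 p.2 := by
      refine Finset.sum_nbij' Prod.swap Prod.swap ?_ ?_ ?_ ?_ ?_
      · intro p hp
        rw [Finset.mem_filter, hT] at hp ⊢
        exact ⟨⟨hp.1.2.1, hp.1.1, by rw [mul_comm]; exact hp.1.2.2⟩, hp.2⟩
      · intro p hp
        rw [Finset.mem_filter, hT] at hp ⊢
        exact ⟨⟨hp.1.2.1, hp.1.1, by rw [mul_comm]; exact hp.1.2.2⟩, hp.2⟩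
      · intros; rfl
      · intros; rfl
      · intro p _
        exact hF _ _
    rw [hswap, ← Finset.sum_filter_add_sum_filter_not (T.filter fun p => p.2 ≤ Q)
      (fun p => ¬ p.1 ≤ Q)]
    congr 1
    · refine Finset.sum_congr ?_ fun _ _ => rfl
      ext p
      simp only [Finset.mem_filter, hT]
      constructor
      · rintro ⟨h, h'⟩
        refine ⟨⟨h, ?_⟩, h'⟩
        by_contra h''
        exact absurd h.2.2 (not_le.2 (hQlt _ _ (not_le.1 h') (not_le.1 h'')))
      · rintro ⟨⟨h, -⟩, h'⟩
        exact ⟨h, h'⟩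
    · refine Finset.sum_congr ?_ fun _ _ => rfl
      ext p
      simp only [Finset.mem_filter, not_not]
      tauto
  have hC : ∑ p ∈ T with (p.1 ≤ Q ∧ p.2 ≤ Q), F p.1 p.2 =
      ∑ a ∈ Finset.Icc 1 Q, ∑ b ∈ Finset.Icc 1 Q, F a b := by
    rw [← Finset.sum_product' (Finset.Icc 1 Q) (Finset.Icc 1 Q) F]
    refine Finset.sum_congr ?_ fun _ _ => rfl
    ext p
    simp only [Finset.mem_filter, hT, Finset.mem_product, Finset.mem_Icc]
    constructor
    · rintro ⟨⟨h1, h2, -⟩, h3, h4⟩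
      exact ⟨⟨h1, h3⟩, h2, h4⟩
    · rintro ⟨⟨h1, h3⟩, h2, h4⟩
      exact ⟨⟨h1, h2, hQle _ _ h3 h4⟩, h3, h4⟩
  rw [hleft, ← Finset.sum_filter_add_sum_filter_not T (fun p => p.1 ≤ Q), hB, hA, hC]
  ring

end

/-! ### The value of the series at `s = 1` -/

theorem sum_Icc_div_eq_sum_range (g : ℕ → ℝ) (N : ℕ) :
    ∑ n ∈ Finset.Icc 1 N, g n / n = ∑ n ∈ Finset.range (N + 1), g n / n := by
  rw [Finset.range_eq_Ico, Finset.sum_eq_sum_Ico_succ_bot (Nat.succ_pos N)]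
  simp only [Nat.cast_zero, div_zero, zero_add]
  rfl

/-- The harmonic sums are `o(Q)`, by Cesàro averaging of `1 / n → 0`. -/
theorem tendsto_harmonic_div :
    Tendsto (fun Q : ℕ => (∑ a ∈ Finset.Icc 1 Q, 1 / (a : ℝ)) / (Q + 1)) atTop (𝓝 0) := by
  have h := (tendsto_add_atTop_iff_nat 1).2 (tendsto_one_div_atTop_nhds_zero_nat (𝕜 := ℝ)).cesaro
  refine h.congr fun Q => ?_
  rw [sum_Icc_div_eq_sum_range (fun _ => 1)]
  push_cast
  rw [inv_mul_eq_div]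

section
variable {k : ℕ} [NeZero k]

theorem zmodSaw_neg (j : ZMod k) : zmodSaw (-j) = -zmodSaw j := by
  rcases eq_or_ne j 0 with rfl | hj
  · simp [zmodSaw]
  rw [zmodSaw, zmodSaw, if_neg hj, if_neg (neg_ne_zero.2 hj), val_neg_cast hj]
  ring

theorem abs_zmodSaw_le (j : ZMod k) : |zmodSaw j| ≤ k := by
  have h0 : (0 : ℝ) ≤ k := k.cast_nonneg
  rw [zmodSaw]
  split_ifs
  · simp
  · have h1 : (j.val : ℝ) ≤ k := Nat.cast_le.2 (ZMod.val_lt j).le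
    have h2 : (0 : ℝ) ≤ j.val := Nat.cast_nonneg _
    rw [abs_le]
    constructor <;> linarith

/-- The bound `|zmodSaw| ≤ k` brings the sawtooth series under the estimate for odd periodic
coefficients of absolute value at most `1`. -/
theorem tendsto_sum_zmodSaw_div (h : ZMod k) :
    Tendsto (fun Q : ℕ => ∑ a ∈ Finset.Icc 1 Q, zmodSaw (h * (a : ZMod k)) / a) atTop
      (𝓝 (Real.pi / (2 * k) * ∑ j, zmodSaw (h * j) * zmodCot j)) := by
  have hk : (0 : ℝ) < k := Nat.cast_pos.2 (NeZero.pos k)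
  have hb := abs_sum_range_odd_div_sub_le (g := fun j : ZMod k => zmodSaw (h * j) / k)
    (fun j => by rw [mul_neg, zmodSaw_neg, neg_div])
    (fun j => by
      rw [abs_div, abs_of_pos hk, div_le_one hk]
      exact abs_zmodSaw_le _)
  have hz : Tendsto (fun M : ℕ => 4 * (k : ℝ) / (M + 1)) atTop (𝓝 0) :=
    tendsto_const_nhds.div_atTop (tendsto_natCast_atTop_atTop.atTop_add tendsto_const_nhds)
  have ht := (tendsto_iff_norm_sub_tendsto_zero.2
    (squeeze_zero (fun _ => norm_nonneg _) hb hz)).mul_const (k : ℝ)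
  have e : Real.pi / (2 * k) * ∑ j, zmodSaw (h * j) * zmodCot j =
      (Real.pi / (2 * k) * ∑ j, zmodSaw (h * j) / k * zmodCot j) * k := by
    rw [Finset.mul_sum, Finset.mul_sum, Finset.sum_mul]
    refine Finset.sum_congr rfl fun j _ => ?_
    field_simp
  rw [e]
  refine ht.congr fun M => ?_
  rw [sum_Icc_div_eq_sum_range (fun a => zmodSaw (h * (a : ZMod k))), Finset.sum_mul]
  refine Finset.sum_congr rfl fun j _ => ?_
  field_simp

/-- The inner sums of the hyperbola method: for fixed `a` the sum over `b` is a sawtooth Fourier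
series. -/
theorem abs_sum_zmodSin_div_sub_le (h : ZMod k) (a : ℕ) {Q y : ℕ} (hy : Q ≤ y) :
    |∑ b ∈ Finset.Icc 1 y, zmodSin (h * ((a : ZMod k) * (b : ZMod k))) / ((a : ℝ) * b) -
      Real.pi / (2 * k) * (zmodSaw (h * (a : ZMod k)) / a)| ≤ 4 * k * (1 / a / (Q + 1)) := by
  have hb := abs_sum_range_odd_div_sub_le (g := fun j : ZMod k => zmodSin (h * (a : ZMod k) * j))
    (fun j => by rw [mul_neg, zmodSin_neg]) (fun j => abs_zmodSin_le _) y
  rw [sum_zmodSin_mul_zmodCot,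
    ← sum_Icc_div_eq_sum_range (fun b => zmodSin (h * (a : ZMod k) * (b : ZMod k)))] at hb
  have e : ∑ b ∈ Finset.Icc 1 y, zmodSin (h * ((a : ZMod k) * (b : ZMod k))) / ((a : ℝ) * b) -
      Real.pi / (2 * k) * (zmodSaw (h * (a : ZMod k)) / a) =
      1 / a * (∑ b ∈ Finset.Icc 1 y, zmodSin (h * (a : ZMod k) * (b : ZMod k)) / b -
        Real.pi / (2 * k) * zmodSaw (h * (a : ZMod k))) := by
    rw [mul_sub, Finset.mul_sum]
    congr 1
    · refine Finset.sum_congr rfl fun b _ => ?_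
      rw [mul_assoc, div_mul_div_comm, one_mul]
    · ring
  have ha : (0 : ℝ) ≤ 1 / a := by positivity
  rw [e, abs_mul, abs_of_nonneg ha]
  calc (1 / a : ℝ) * _ ≤ 1 / a * (4 * k / (y + 1)) := mul_le_mul_of_nonneg_left hb ha
    _ ≤ 1 / a * (4 * k / (Q + 1)) := by
        have : (Q : ℝ) ≤ y := Nat.cast_le.2 hy
        gcongr
    _ = _ := by ring

/-- The hyperbola method replaces the partial sum up to `N` by a sawtooth sum up to `√N`: in each
of its double sums the inner variable runs at least up to `√N`, so that the inner sum may be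
completed at a total cost of `O(log N / √N)`. -/
theorem abs_sum_esinCoeff_div_sub_le (h : ℤ) (N : ℕ) :
    |∑ n ∈ Finset.Icc 1 N, esinCoeff h k n / n -
      Real.pi / (2 * k) * ∑ a ∈ Finset.Icc 1 N.sqrt, zmodSaw ((h : ZMod k) * (a : ZMod k)) / a| ≤
    12 * k * ((∑ a ∈ Finset.Icc 1 N.sqrt, 1 / (a : ℝ)) / (N.sqrt + 1)) := by
  set Q := N.sqrt with hQ
  let F : ℕ → ℕ → ℝ := fun a b =>
    zmodSin ((h : ZMod k) * ((a : ZMod k) * (b : ZMod k))) / ((a : ℝ) * b)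
  let c : ℕ → ℝ := fun a => Real.pi / (2 * k) * (zmodSaw ((h : ZMod k) * (a : ZMod k)) / a)
  have hS : ∑ n ∈ Finset.Icc 1 N, esinCoeff h k n / n =
      ∑ n ∈ Finset.Icc 1 N, ∑ p ∈ n.divisorsAntidiagonal, F p.1 p.2 := by
    refine Finset.sum_congr rfl fun n _ => ?_
    have : ∀ p ∈ n.divisorsAntidiagonal, F p.1 p.2 =
        zmodSin ((h : ZMod k) * (n : ZMod k)) / n := by
      intro p hp
      rw [← (Nat.mem_divisorsAntidiagonal.1 hp).1]
      simp only [F]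
      push_cast
      rfl
    rw [Finset.sum_congr rfl this, Finset.sum_const, esinCoeff_eq (k := k),
      ← Nat.map_div_right_divisors, Finset.card_map, nsmul_eq_mul, mul_div_assoc]
  have hF : ∀ a b, F a b = F b a := fun a b => by
    simp only [F]
    rw [mul_comm (a : ZMod k), mul_comm (a : ℝ)]
  have h1 : ∀ a ∈ Finset.Icc 1 Q, |2 * (∑ b ∈ Finset.Icc 1 (N / a), F a b - c a) -
      (∑ b ∈ Finset.Icc 1 Q, F a b - c a)| ≤ 12 * k * (1 / a / (Q + 1)) := by
    intro a ha
    rw [Finset.mem_Icc] at ha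
    have hQa : Q ≤ N / a := (Nat.le_div_iff_mul_le ha.1).2
      ((Nat.mul_le_mul_left Q ha.2).trans (Nat.sqrt_le N))
    have b1 := abs_sum_zmodSin_div_sub_le (h : ZMod k) a hQa
    have b2 := abs_sum_zmodSin_div_sub_le (h : ZMod k) a (le_refl Q)
    refine (abs_sub _ _).trans ?_
    rw [abs_mul, abs_two]
    simp only [F, c]
    linarith
  have e : ∑ n ∈ Finset.Icc 1 N, esinCoeff h k n / n -
      Real.pi / (2 * k) * ∑ a ∈ Finset.Icc 1 Q, zmodSaw ((h : ZMod k) * (a : ZMod k)) / a =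
      ∑ a ∈ Finset.Icc 1 Q, (2 * (∑ b ∈ Finset.Icc 1 (N / a), F a b - c a) -
        (∑ b ∈ Finset.Icc 1 Q, F a b - c a)) := by
    have hc : Real.pi / (2 * k) *
        ∑ a ∈ Finset.Icc 1 Q, zmodSaw ((h : ZMod k) * (a : ZMod k)) / a =
        ∑ a ∈ Finset.Icc 1 Q, c a := Finset.mul_sum _ _ _
    rw [hS, sum_divisorsAntidiagonal_eq_hyperbola hF, hc, ← hQ]
    simp only [mul_sub, Finset.sum_sub_distrib, ← Finset.mul_sum]
    ring
  rw [e, Finset.sum_div, Finset.mul_sum]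
  exact (Finset.abs_sum_le_sum_abs _ _).trans (Finset.sum_le_sum h1)

theorem tendsto_sum_esinCoeff_div {h : ℤ} (hh : IsUnit (h : ZMod k)) :
    Tendsto (fun N : ℕ => ∑ n ∈ Finset.Icc 1 N, esinCoeff h k n / n) atTop
      (𝓝 (-(Real.pi ^ 2 / (2 * k)) * vasyuninSum h k)) := by
  have hk : (k : ℝ) ≠ 0 := Nat.cast_ne_zero.2 (NeZero.ne k)
  have hsqrt : Tendsto Nat.sqrt atTop atTop :=
    tendsto_atTop.2 fun b => (eventually_ge_atTop (b * b)).mono fun n hn => Nat.le_sqrt.2 hn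
  have hmain := ((tendsto_sum_zmodSaw_div (h : ZMod k)).comp hsqrt).const_mul (Real.pi / (2 * k))
  have herr := (tendsto_harmonic_div.comp hsqrt).const_mul (12 * (k : ℝ))
  rw [mul_zero] at herr
  have hdiff : Tendsto (fun N : ℕ => ∑ n ∈ Finset.Icc 1 N, esinCoeff h k n / n -
      Real.pi / (2 * k) * ∑ a ∈ Finset.Icc 1 N.sqrt, zmodSaw ((h : ZMod k) * (a : ZMod k)) / a)
      atTop (𝓝 0) :=
    squeeze_zero_norm (fun N => abs_sum_esinCoeff_div_sub_le h N) herr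
  have hsum := hdiff.add hmain
  have e : 0 + Real.pi / (2 * k) * (Real.pi / (2 * k) *
      ∑ j : ZMod k, zmodSaw ((h : ZMod k) * j) * zmodCot j) =
      -(Real.pi ^ 2 / (2 * k)) * vasyuninSum h k := by
    simp only [mul_comm (h : ZMod k)]
    rw [sum_zmodSaw_mul_zmodCot hh]
    field_simp
    ring
  rw [e] at hsum
  refine hsum.congr fun N => ?_
  simp only [Function.comp_apply]
  ring

theorem Esin_eq_esinEntire (h : ℤ) : Esin h k = esinEntire (h : ZMod k) := by
  have H : ∃ F : ℂ → ℂ, IsEntireContinuation (fun n => (esinCoeff h k n : ℂ)) F :=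
    ⟨_, isEntireContinuation_esinEntire h⟩
  rw [Esin, dif_pos H]
  exact H.choose_spec.unique (isEntireContinuation_esinEntire h)

end

theorem mainTheorem11 (h : ℤ) (k : ℕ) (hk : 0 < k) (hcop : IsCoprime h (k : ℤ)) :
    IsEntireContinuation (fun n => (esinCoeff h k n : ℂ)) (Esin h k) ∧
    (∀ hbar : ℤ, h * hbar ≡ 1 [ZMOD (k : ℤ)] →
      Esin h k 0 = ((-(1 / 2) * vasyuninSum hbar k : ℝ) : ℂ)) ∧
    Esin h k 1 = ((-(Real.pi ^ 2 / (2 * k)) * vasyuninSum h k : ℝ) : ℂ) ∧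
    Tendsto (fun N : ℕ => ∑ n ∈ Finset.Icc 1 N, esinCoeff h k n / n) atTop
      (𝓝 (-(Real.pi ^ 2 / (2 * k)) * vasyuninSum h k)) := by
  have : NeZero k := ⟨hk.ne'⟩
  have hu : IsUnit (h : ZMod k) := by
    obtain ⟨u, v, huv⟩ := hcop
    refine IsUnit.of_mul_eq_one (u : ZMod k) ?_
    have := congrArg (Int.cast : ℤ → ZMod k) huv
    push_cast at this
    rw [CharP.cast_eq_zero, mul_zero, add_zero] at this
    rw [mul_comm, this]
  rw [Esin_eq_esinEntire]
  refine ⟨isEntireContinuation_esinEntire h, fun hbar hb => esinEntire_zero ?_, esinEntire_one hu,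
    tendsto_sum_esinCoeff_div hu⟩
  have := (ZMod.intCast_eq_intCast_iff (h * hbar) 1 k).2 hb
  simpa using this
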